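/- Let $d\in\{2,3\}$, let $\Omega\subset\mathbb R^d$ be a bounded domain and let $\nu>0$. Put $H=[L^2(\Omega)]^d$, $V=[H^1_0(\Omega)]^d$, $Q=L^2_0(\Omega)=\{q\in L^2(\Omega):\int_\Omega q=0\}$, let $(\cdot,\cdot)$ denote the $L^2(\Omega)$ inner products, and let $$a(u,v)=(\nu\nabla u,\nabla v),\qquad b(p,v)=-(p,\nabla\cdot v),\qquad \|v\|_V=a(v,v)^{1/2}=\|\nu^{1/2}\nabla v\|_{L^2}.$$ Let $\mathcal T_h$ be a finite conforming simplicial triangulation of $\overline\Omega$, and let $k\ge 1$ and $l\geq 0$ be integers with $k-1\le l\le k$. Let $X_h$ be the space of functions in $C(\Omega)$ that are polynomials of degree at most $k$ on each cell of $\mathcal T_h$, let $M_h$ be the space of functions in $L^2(\Omega)$ that are polynomials of degree at most $l$ on each cell, and put $V_h=[X_h]^d\cap V$ and either $Q_h=M_h\cap Q$ or $Q_h=M_h\cap Q\cap C^0(\overline\Omega)$. Let $j_h:Q_h\times Q_h\to\mathbb R$ be a symmetric positive semi-definite bilinear form, with seminorm $|p|_{j_h}=j_h(p,p)^{1/2}$.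 Let $q=6$ and let $\delta_0,\dots,\delta_6$ be the coefficients of the six-step backward difference formula, $\sum_{i=0}^{6}\delta_i\zeta^i=\sum_{m=1}^{6}\frac1m(1-\zeta)^m$. For a time step $\tau>0$ write $t_n=n\tau$ and $$\bar\partial_q u^n=\frac1\tau\sum_{i=0}^{6}\delta_i u^{n-i}\qquad(n\ge 6).$$ Let $T>0$, let $N\ge 0$ be an integer with $N\tau\le T$, let $f\in C^0([0,T];H)$, and put $f^n=f(t_n)$. For a sequence $w$ in $H$ let $\|w\|_{\ell^2(J_q;H)}^2=\tau\sum_{n=6}^{N}\|w^n\|_H^2$. Let $u_h^0,\dots,u_h^5\in V_h$ be initial values that are discretely divergence-free, with corresponding $p_h^0,\dots,p_h^5\in Q_h$: $$b(q_h,u_h^i)-j_h(p_h^i,q_h)=0\qquad\text{for all }q_h\in Q_h,\quad i=0,\dots,5,$$ and let $(u_h^n,p_h^n)\in V_h\times Q_h$, $6\le n\le N$, be a solution of the fully discrete problem $$(\bar\partial_q u_h^n,v_h)+a(u_h^n,v_h)+b(p_h^n,v_h)=(f^n,v_h)\quad\text{for all }v_h\in V_h,$$ $$b(q_h,u_h^n)-j_h(q_h,p_h^n)=0\quad\text{for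 all }q_h\in Q_h.$$ Then $$\|\bar\partial_q u_h\|_{\ell^2(J_q;H)}^2+\|u_h^N\|_V^2+|p_h^N|_{j_h}^2\le C\Bigl[\sum_{i=0}^{5}\bigl(\|u_h^i\|_V^2+|p_h^i|_{j_h}^2\bigr)+\|f\|_{\ell^2(J_q;H)}^2\Bigr],$$ where $C>0$ is an absolute constant; in particular it is independent of the triangulation (hence of the mesh size $h$), $N$, $\tau$ and $T$, and also of $\nu$, $\Omega$, $d$, $k$, $l$, $j_h$, $f$ and the initial values. -/

import Mathlib

open MeasureTheory Set
open scoped ContDiff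

noncomputable section

namespace TransientStokes

/-! ### Function spaces on a bounded domain -/

/-- The space `ℝ^d` with its Euclidean norm. -/
abbrev Space (d : ℕ) : Type := EuclideanSpace ℝ (Fin d)

/-- A bounded domain (nonempty, open, connected, bounded set) of `ℝ^d`. -/
structure Domain (d : ℕ) where
  carrier : Set (Space d)
  isOpen : IsOpen carrier
  isConnected : IsConnected carrier
  isBounded : Bornology.IsBounded carrier

variable {d : ℕ}

/-- Lebesgue measure on the domain. -/
def Domain.vol (Ω : Domain d) : Measure (Space d) := volume.restrict Ω.carrier

instance (Ω : Domain d) : IsFiniteMeasure Ω.vol :=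
  ⟨by
    simp only [Domain.vol, Measure.restrict_apply_univ]
    exact Ω.isBounded.measure_lt_top⟩

/-- The space `L²(Ω)` of real-valued functions. -/
abbrev L2 (Ω : Domain d) : Type := Lp ℝ 2 Ω.vol

/-- The velocity pivot space `H = [L²(Ω)]^d` with its Hilbert norm and inner product. -/
abbrev H (Ω : Domain d) : Type := PiLp 2 (fun _ : Fin d => L2 Ω)

theorem L2.integrable {Ω : Domain d} (w : L2 Ω) : Integrable w Ω.vol :=
  (Lp.memLp w).integrable (by norm_num)

/-- The pressure space `Q = L²₀(Ω)` of square integrable functions of mean zero. -/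
def L20 (Ω : Domain d) : Submodule ℝ (L2 Ω) where
  carrier := {q | ∫ x, q x ∂Ω.vol = 0}
  zero_mem' := by
    simp only [mem_ofPred_eq]
    rw [integral_congr_ae (Lp.coeFn_zero ℝ 2 Ω.vol)]
    simp
  add_mem' := by
    intro p q hp hq
    simp only [mem_ofPred_eq] at *
    rw [integral_congr_ae (Lp.coeFn_add p q)]
    simp only [Pi.add_apply]
    rw [integral_add p.integrable q.integrable, hp, hq, add_zero]
  smul_mem' := by
    intro c q hq
    simp only [mem_ofPred_eq] at *
    rw [integral_congr_ae (Lp.coeFn_smul c q)]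
    simp only [Pi.smul_apply]
    rw [integral_smul, hq, smul_zero]

/-- The test functions `C_c^∞(Ω)`. -/
def IsTest (Ω : Domain d) (φ : Space d → ℝ) : Prop :=
  ContDiff ℝ ∞ φ ∧ HasCompactSupport φ ∧ tsupport φ ⊆ Ω.carrier

/-- The classical partial derivative `∂_i φ`. -/
def partialDeriv (i : Fin d) (φ : Space d → ℝ) (x : Space d) : ℝ :=
  fderiv ℝ φ x (EuclideanSpace.single i 1)

/-- `g` is the weak partial derivative `∂_i w` on `Ω`. -/
def IsWeakPartial (Ω : Domain d) (i : Fin d) (w g : L2 Ω) : Prop :=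
  ∀ φ : Space d → ℝ, IsTest Ω φ →
    ∫ x, w x * partialDeriv i φ x ∂Ω.vol = -∫ x, g x * φ x ∂Ω.vol

theorem IsTest.continuous_partialDeriv {Ω : Domain d} {φ : Space d → ℝ} (h : IsTest Ω φ)
    (i : Fin d) : Continuous (partialDeriv i φ) :=
  (h.1.continuous_fderiv (by simp)).clm_apply continuous_const

theorem IsTest.hasCompactSupport_partialDeriv {Ω : Domain d} {φ : Space d → ℝ} (h : IsTest Ω φ)
    (i : Fin d) : HasCompactSupport (partialDeriv i φ) :=
  h.2.1.fderiv_apply (𝕜 := ℝ) _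

theorem L2.integrable_mul {Ω : Domain d} (w : L2 Ω) {ψ : Space d → ℝ} (h : Continuous ψ)
    (hc : HasCompactSupport ψ) : Integrable (fun x => w x * ψ x) Ω.vol := by
  obtain ⟨c, hc⟩ := hc.exists_bound_of_continuous h
  exact w.integrable.mul_bdd h.aestronglyMeasurable (Filter.Eventually.of_forall hc)

/-- The Sobolev space `H¹(Ω)`. An element is stored as the pair `(w, ∇w)` of an `L²` function and
its weak gradient; the gradient is determined by `w`, see `IsWeakPartial.unique`. -/
def H1 (Ω : Domain d) : Submodule ℝ (L2 Ω × (Fin d → L2 Ω)) where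
  carrier := {z | ∀ i, IsWeakPartial Ω i z.1 (z.2 i)}
  zero_mem' := by
    intro i φ _
    have h : ∀ᵐ x ∂Ω.vol, (0 : L2 Ω) x = 0 := Lp.coeFn_zero ℝ 2 Ω.vol
    simp only [Prod.fst_zero, Prod.snd_zero, Pi.zero_apply]
    rw [integral_eq_zero_of_ae (h.mono fun x hx => by
        rw [hx, zero_mul, Pi.zero_apply]),
      integral_eq_zero_of_ae (h.mono fun x hx => by
        rw [hx, zero_mul, Pi.zero_apply]), neg_zero]
  add_mem' := by
    intro z z' hz hz' i φ hφ
    have e1 : ∀ (w w' : L2 Ω) (ψ : Space d → ℝ), Continuous ψ → HasCompactSupport ψ →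
        ∫ x, (w + w') x * ψ x ∂Ω.vol = ∫ x, w x * ψ x ∂Ω.vol + ∫ x, w' x * ψ x ∂Ω.vol := by
      intro w w' ψ h hc
      rw [← integral_add (w.integrable_mul h hc) (w'.integrable_mul h hc)]
      refine integral_congr_ae ((Lp.coeFn_add w w').mono fun x hx => ?_)
      simp only [hx, Pi.add_apply, add_mul]
    have h1 := hz i φ hφ
    have h2 := hz' i φ hφ
    simp only [Prod.fst_add, Prod.snd_add, Pi.add_apply]
    rw [e1 _ _ _ (hφ.continuous_partialDeriv i) (hφ.hasCompactSupport_partialDeriv i),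
      e1 _ _ _ hφ.1.continuous hφ.2.1, h1, h2]
    ring
  smul_mem' := by
    intro c z hz i φ hφ
    have e1 : ∀ (w : L2 Ω) (ψ : Space d → ℝ),
        ∫ x, (c • w) x * ψ x ∂Ω.vol = c * ∫ x, w x * ψ x ∂Ω.vol := by
      intro w ψ
      rw [← integral_const_mul]
      refine integral_congr_ae ((Lp.coeFn_smul c w).mono fun x hx => ?_)
      simp only [hx, Pi.smul_apply, smul_eq_mul, mul_assoc]
    have h1 := hz i φ hφ
    simp only [Prod.smul_fst, Prod.smul_snd, Pi.smul_apply]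
    rw [e1, e1, h1]
    ring

/-- Weak partial derivatives are unique. -/
theorem IsWeakPartial.unique {Ω : Domain d} {i : Fin d} {w g g' : L2 Ω}
    (h : IsWeakPartial Ω i w g) (h' : IsWeakPartial Ω i w g') : g = g' := by
  have key := Ω.isOpen.ae_eq_zero_of_integral_contDiff_smul_eq_zero (μ := volume)
    (f := fun x => g x - g' x)
    (IntegrableOn.locallyIntegrableOn
      (show Integrable _ (volume.restrict Ω.carrier) from g.integrable.sub g'.integrable))
    (fun φ hφ hc hs => by
      have hφt : IsTest Ω φ := ⟨hφ, hc, hs⟩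
      have e := (h φ hφt).symm.trans (h' φ hφt)
      have e2 : ∫ x in Ω.carrier, φ x • (g x - g' x) = 0 := by
        have : ∫ x, (g x * φ x - g' x * φ x) ∂Ω.vol = 0 := by
          rw [integral_sub (g.integrable_mul hφ.continuous hc)
            (g'.integrable_mul hφ.continuous hc)]
          linarith
        rw [← this]
        refine integral_congr_ae (Filter.Eventually.of_forall fun x => ?_)
        simp only [smul_eq_mul]
        ring
      rw [← e2]
      refine (setIntegral_eq_integral_of_forall_compl_eq_zero fun x hx => ?_).symm
      have : φ x = 0 := image_eq_zero_of_notMem_tsupport fun hx' => hx (hs hx')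
      simp [this])
  refine Lp.ext ?_
  have key2 : ∀ᵐ x ∂Ω.vol, g x - g' x = 0 :=
    (ae_restrict_iff' Ω.isOpen.measurableSet).2 key
  exact key2.mono fun x hx => sub_eq_zero.1 hx

/-- The pairs `(φ, ∇φ)` with `φ ∈ C_c^∞(Ω)`. -/
def testPairs (Ω : Domain d) : Submodule ℝ (L2 Ω × (Fin d → L2 Ω)) where
  carrier := {z | ∃ φ : Space d → ℝ, IsTest Ω φ ∧ z.1 =ᵐ[Ω.vol] φ ∧
    ∀ i, z.2 i =ᵐ[Ω.vol] partialDeriv i φ}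
  zero_mem' := by
    refine ⟨fun _ => 0, ⟨contDiff_const, HasCompactSupport.zero, ?_⟩, Lp.coeFn_zero ℝ 2 Ω.vol,
      fun i => ?_⟩
    · simp [tsupport]
    · refine (Lp.coeFn_zero ℝ 2 Ω.vol).trans (Filter.Eventually.of_forall fun x => ?_)
      simp [partialDeriv]
  add_mem' := by
    rintro z z' ⟨φ, hφ, h1, h2⟩ ⟨φ', hφ', h1', h2'⟩
    refine ⟨φ + φ', ⟨hφ.1.add hφ'.1, hφ.2.1.add hφ'.2.1,
      (tsupport_add φ φ').trans (union_subset hφ.2.2 hφ'.2.2)⟩,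
      (Lp.coeFn_add _ _).trans (h1.add h1'), fun i => ?_⟩
    refine (Lp.coeFn_add _ _).trans (((h2 i).add (h2' i)).trans
      (Filter.Eventually.of_forall fun x => ?_))
    simp only [partialDeriv, Pi.add_apply]
    rw [fderiv_add ((hφ.1.differentiable (by simp)) x) ((hφ'.1.differentiable (by simp)) x)]
    rfl
  smul_mem' := by
    rintro c z ⟨φ, hφ, h1, h2⟩
    have hs : tsupport (c • φ) ⊆ tsupport φ := tsupport_smul_subset_right (fun _ => c) φ
    refine ⟨c • φ, ⟨contDiff_const.smul hφ.1, hφ.2.1.smul_left (f := fun _ => c),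
      hs.trans hφ.2.2⟩, (Lp.coeFn_smul _ _).trans (h1.const_smul c), fun i => ?_⟩
    refine (Lp.coeFn_smul _ _).trans (((h2 i).const_smul c).trans
      (Filter.Eventually.of_forall fun x => ?_))
    simp only [partialDeriv, Pi.smul_apply]
    rw [fderiv_const_smul ((hφ.1.differentiable (by simp)) x)]
    rfl

/-- `H¹₀(Ω)`: the closure of `C_c^∞(Ω)` in `H¹(Ω)`. (The topology of `L² × (L²)^d`
restricted to pairs `(w, ∇w)` is the topology of the `H¹` norm.) -/
def H10 (Ω : Domain d) : Submodule ℝ (L2 Ω × (Fin d → L2 Ω)) :=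
  H1 Ω ⊓ (testPairs Ω).topologicalClosure

/-- The velocity space `V = [H¹₀(Ω)]^d`. -/
abbrev V (Ω : Domain d) : Type := Fin d → H10 Ω

/-- The embedding of `V` in `H`. -/
def V.toH {Ω : Domain d} (u : V Ω) : H Ω := WithLp.toLp 2 fun i => (u i).1.1

/-- The partial derivative `∂_j u_i`. -/
def V.grad {Ω : Domain d} (u : V Ω) (i j : Fin d) : L2 Ω := (u i).1.2 j

/-- The divergence `∇ · u`. -/
def V.div {Ω : Domain d} (u : V Ω) : L2 Ω := ∑ i, u.grad i i

/-- The bilinear form `a(u, v) = (ν ∇u, ∇v)`. -/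
def aForm {Ω : Domain d} (ν : ℝ) (u v : V Ω) : ℝ :=
  ν * ∑ i, ∑ j, inner ℝ (u.grad i j) (v.grad i j)

/-- The bilinear form `b(p, v) = -(p, ∇ · v)`. -/
def bForm {Ω : Domain d} (p : L2 Ω) (v : V Ω) : ℝ := -inner ℝ p v.div

/-- The energy norm `‖v‖_V = ‖ν^{1/2} ∇v‖_H = a(v, v)^{1/2}`. -/
def normV {Ω : Domain d} (ν : ℝ) (v : V Ω) : ℝ := Real.sqrt (aForm ν v v)

/-! ### Finite element spaces -/

/-- A triangulation of the domain: a finite conforming simplicial mesh, all of whose simplices are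
faces of `d`-dimensional ones, and whose union is the closure of the domain. -/
structure Mesh (Ω : Domain d) where
  complex : Geometry.SimplicialComplex ℝ (Space d)
  finite : complex.faces.Finite
  pure : ∀ s ∈ complex.faces, ∃ t ∈ complex.faces, s ⊆ t ∧ t.card = d + 1
  space_eq : complex.space = closure Ω.carrier

/-- The cells of the mesh, that is the closed `d`-simplices. -/
def Mesh.cells {Ω : Domain d} (T : Mesh Ω) : Set (Set (Space d)) :=
  {K | ∃ s ∈ T.complex.faces, s.card = d + 1 ∧ K = convexHull ℝ (s : Set (Space d))}

/-- The value at `x` of a polynomial in `d` variables. -/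
def polyEval (P : MvPolynomial (Fin d) ℝ) (x : Space d) : ℝ := MvPolynomial.eval (fun i => x i) P

/-- `X_h`: the functions in `C(Ω)` that are polynomials of degree at most `k` on each cell. -/
def contSpace {Ω : Domain d} (T : Mesh Ω) (k : ℕ) : Submodule ℝ (L2 Ω) where
  carrier := {w | ∃ g : Space d → ℝ, w =ᵐ[Ω.vol] g ∧ ContinuousOn g Ω.carrier ∧
    ∀ K ∈ T.cells, ∃ P : MvPolynomial (Fin d) ℝ, P.totalDegree ≤ k ∧
      ∀ x ∈ K ∩ Ω.carrier, g x = polyEval P x}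
  zero_mem' := ⟨fun _ => 0, Lp.coeFn_zero ℝ 2 Ω.vol, continuousOn_const,
    fun _ _ => ⟨0, by simp, by simp [polyEval]⟩⟩
  add_mem' := by
    rintro w w' ⟨g, h1, h2, h3⟩ ⟨g', h1', h2', h3'⟩
    refine ⟨g + g', (Lp.coeFn_add _ _).trans (h1.add h1'), h2.add h2', fun K hK => ?_⟩
    obtain ⟨P, hP, e⟩ := h3 K hK
    obtain ⟨P', hP', e'⟩ := h3' K hK
    exact ⟨P + P', (MvPolynomial.totalDegree_add P P').trans (max_le hP hP'),
      fun x hx => by simp [polyEval, e x hx, e' x hx]⟩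
  smul_mem' := by
    rintro c w ⟨g, h1, h2, h3⟩
    refine ⟨c • g, (Lp.coeFn_smul _ _).trans (h1.const_smul c), h2.const_smul c, fun K hK => ?_⟩
    obtain ⟨P, hP, e⟩ := h3 K hK
    exact ⟨c • P, (MvPolynomial.totalDegree_smul_le c P).trans hP,
      fun x hx => by simp [polyEval, e x hx]⟩

/-- `M_h`: the functions in `L²(Ω)` that are polynomials of degree at most `l` on each cell. -/
def discSpace {Ω : Domain d} (T : Mesh Ω) (l : ℕ) : Submodule ℝ (L2 Ω) where
  carrier := {w | ∀ K ∈ T.cells, ∃ P : MvPolynomial (Fin d) ℝ, P.totalDegree ≤ l ∧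
    ∀ᵐ x ∂Ω.vol, x ∈ K → w x = polyEval P x}
  zero_mem' := fun _ _ => ⟨0, by simp, (Lp.coeFn_zero ℝ 2 Ω.vol).mono fun x hx _ => by
    rw [hx]
    simp [polyEval]⟩
  add_mem' := by
    intro w w' h h' K hK
    obtain ⟨P, hP, e⟩ := h K hK
    obtain ⟨P', hP', e'⟩ := h' K hK
    refine ⟨P + P', (MvPolynomial.totalDegree_add P P').trans (max_le hP hP'), ?_⟩
    filter_upwards [Lp.coeFn_add w w', e, e'] with x hx h1 h2 hK
    rw [hx, Pi.add_apply, h1 hK, h2 hK]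
    simp [polyEval]
  smul_mem' := by
    intro c w h K hK
    obtain ⟨P, hP, e⟩ := h K hK
    refine ⟨c • P, (MvPolynomial.totalDegree_smul_le c P).trans hP, ?_⟩
    filter_upwards [Lp.coeFn_smul c w, e] with x hx h1 hK
    rw [hx, Pi.smul_apply, h1 hK]
    simp [polyEval]

/-- `C⁰(closure Ω)`, as a subspace of `L²(Ω)`. -/
def contClosure (Ω : Domain d) : Submodule ℝ (L2 Ω) where
  carrier := {w | ∃ g : Space d → ℝ, w =ᵐ[Ω.vol] g ∧ ContinuousOn g (closure Ω.carrier)}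
  zero_mem' := ⟨fun _ => 0, Lp.coeFn_zero ℝ 2 Ω.vol, continuousOn_const⟩
  add_mem' := by
    rintro w w' ⟨g, h1, h2⟩ ⟨g', h1', h2'⟩
    exact ⟨g + g', (Lp.coeFn_add _ _).trans (h1.add h1'), h2.add h2'⟩
  smul_mem' := by
    rintro c w ⟨g, h1, h2⟩
    exact ⟨c • g, (Lp.coeFn_smul _ _).trans (h1.const_smul c), h2.const_smul c⟩

/-- The discrete velocity space `V_h = [X_h]^d ∩ V`. -/
def velocitySpace {Ω : Domain d} (T : Mesh Ω) (k : ℕ) : Submodule ℝ (V Ω) where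
  carrier := {u | ∀ i, (u i).1.1 ∈ contSpace T k}
  zero_mem' := fun _ => (contSpace T k).zero_mem
  add_mem' := fun h h' i => (contSpace T k).add_mem (h i) (h' i)
  smul_mem' := fun c _ h i => (contSpace T k).smul_mem c (h i)

/-- The two choices `Q_h = M_h ∩ Q` and `Q_h = M_h ∩ Q ∩ C⁰(closure Ω)` of the discrete
pressure space. -/
def IsPressureSpace {Ω : Domain d} (T : Mesh Ω) (l : ℕ) (Qh : Submodule ℝ (L2 Ω)) : Prop :=
  Qh = discSpace T l ⊓ L20 Ω ∨ Qh = discSpace T l ⊓ L20 Ω ⊓ contClosure Ω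

/-- A pressure stabilization form: a symmetric positive semi-definite bilinear form on `Q_h`. -/
structure IsStabilization {Ω : Domain d} {Qh : Submodule ℝ (L2 Ω)}
    (j : LinearMap.BilinForm ℝ Qh) : Prop where
  symm : ∀ p q, j p q = j q p
  nonneg : ∀ p, 0 ≤ j p p

/-- The seminorm `|p|_{j_h} = j_h(p, p)^{1/2}`. -/
def seminormJ {Ω : Domain d} {Qh : Submodule ℝ (L2 Ω)} (j : LinearMap.BilinForm ℝ Qh)
    (p : Qh) : ℝ := Real.sqrt (j p p)

/-! ### Backward difference formulae -/

/-- The generating polynomial `δ(ζ) = ∑_{l=1}^q (1/l) (1 - ζ)^l` of the `q`-step method. -/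
def bdfPoly (q : ℕ) : Polynomial ℝ :=
  ∑ l ∈ Finset.Icc 1 q, Polynomial.C (1 / (l : ℝ)) * (1 - Polynomial.X) ^ l

/-- The coefficients `δ_i` of the `q`-step method. -/
def bdfCoeff (q i : ℕ) : ℝ := (bdfPoly q).coeff i

/-- The discrete time derivative `τ⁻¹ ∑_{i=0}^q δ_i u^{n-i}`, meaningful for `n ≥ q`. -/
def bdfDeriv {W : Type*} [AddCommGroup W] [Module ℝ W] (q : ℕ) (τ : ℝ) (u : ℕ → W) (n : ℕ) : W :=
  (1 / τ) • ∑ i ∈ Finset.range (q + 1), bdfCoeff q i • u (n - i)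

/-- The discrete norm `(τ ∑_{n=q}^N ‖w^n‖²)^{1/2}` of `ℓ²(J_q; W)`. -/
def ell2Norm {W : Type*} [NormedAddCommGroup W] (q N : ℕ) (τ : ℝ) (w : ℕ → W) : ℝ :=
  Real.sqrt (τ * ∑ n ∈ Finset.Icc q N, ‖w n‖ ^ 2)

/-- `(u^n, p^n)` solves the fully discrete momentum and continuity equations at step `n`, where
`t_n = n τ`. -/
structure IsStep {Ω : Domain d} (q : ℕ) (ν τ : ℝ) (f : ℝ → H Ω) {Vh : Submodule ℝ (V Ω)}
    {Qh : Submodule ℝ (L2 Ω)} (j : LinearMap.BilinForm ℝ Qh) (u : ℕ → Vh) (p : ℕ → Qh)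
    (n : ℕ) : Prop where
  momentum : ∀ v : Vh,
    inner ℝ (V.toH (bdfDeriv q τ u n : Vh).1) (V.toH v.1) + aForm ν (u n).1 v.1
      + bForm (p n).1 v.1 = inner ℝ (f (n * τ)) (V.toH v.1)
  continuity : ∀ r : Qh, bForm r.1 (u n).1 - j r (p n) = 0

/-- `u` is discretely divergence-free with corresponding discrete pressure `p`. -/
def IsDiscretelyDivFree {Ω : Domain d} {Vh : Submodule ℝ (V Ω)}
    {Qh : Submodule ℝ (L2 Ω)} (j : LinearMap.BilinForm ℝ Qh) (u : Vh) (p : Qh) : Prop :=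
  ∀ r : Qh, bForm r.1 u.1 - j p r = 0

end TransientStokes

end

open TransientStokes

/-! Write `x n` for the pair (velocity, pressure), `D n` for its undivided difference, `m` for the
L² form divided by `τ`, and `E = a + j`. Each `D k` is a combination of discretely divergence-free
pairs, so testing step `n` with it turns the pressure term into `j` and leaves `m (D n) (D k) + E (x
n) (D k) = (f n, D k)`. The saddle-point structure and `τ` disappear from the algebra.

The six-step method is not A-stable, so testing with `D n` alone does not telescope. Instead the
equations at `n`, `n-1`, `n-2`, `n-3` are combined with the coefficients of `μ(ζ) = 36 - 52ζ + 25ζ²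
- 4ζ³` and tested with `D n`. On the unit circle `Re μ ≥ 1` and `Re (μ · conj δ) ≥ 0`. In the spirit
of Dahlquist's G-stability, both facts are realised by explicit quadratic Lyapunov functionals and
sums of squares (`multiplierLyapunov_le_add`, `bdfLyapunov_le_add`). Hence the `m`-part yields `m (D
n) (D n)` and the `E`-part telescopes (`potential_step`). Summation needs no Gronwall argument, so
the constant is absolute. The first three steps, where the combination would reach back to missing
equations, are bounded crudely (`step_le`). -/

noncomputable section

namespace TransientStokes

/-! ### Sum-of-squares certificates for the multiplier -/

section BackwardDifference

variable {W : Type*} [AddCommGroup W] [Module ℝ W]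

/-- The Lyapunov functional of the six-step backward difference formula paired with the multiplier
`36 - 52 ζ + 25 ζ² - 4 ζ³`. -/
def bdfLyapunov (B : LinearMap.BilinForm ℝ W) (y0 y1 y2 y3 y4 y5 : W) : ℝ :=
  10335 / 2 * B y0 y0 - 19740 * B y0 y1 + 18480 * B y0 y2 - 13380 * B y0 y3 + 6600 * B y0 y4 -
    1560 * B y0 y5 + 44355 / 2 * B y1 y1 - 45900 * B y1 y2 + 33120 * B y1 y3 - 18060 * B y1 y4 +
    5160 * B y1 y5 + 53865 / 2 * B y2 y2 - 40920 * B y2 y3 + 23400 * B y2 y4 - 7740 * B y2 y5 +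
    34705 / 2 * B y3 y3 - 21420 * B y3 y4 + 7080 * B y3 y5 + 8015 * B y4 y4 - 6240 * B y4 y5 +
    1625 * B y5 y5

/-- The Lyapunov functional showing that `36 - 52 ζ + 25 ζ² - 4 ζ³` has real part at least `1` on
the closed unit disc. -/
def multiplierLyapunov (B : LinearMap.BilinForm ℝ W) (y0 y1 y2 : W) : ℝ :=
  32 * B y0 y0 - 208 / 5 * B y0 y1 + 74 / 5 * B y0 y2 + 94 / 5 * B y1 y1 - 76 / 5 * B y1 y2 +
    27 / 5 * B y2 y2

theorem two_mul_abs_le {B : LinearMap.BilinForm ℝ W} (hs : ∀ x y, B x y = B y x)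
    (hB : ∀ x, 0 ≤ B x x) (x y : W) : 2 * |B x y| ≤ B x x + B y y := by
  have h1 := hB (x + y)
  have h2 := hB (x - y)
  simp only [map_add, map_sub, LinearMap.add_apply, LinearMap.sub_apply, hs y x] at h1 h2
  rcases abs_cases (B x y) with h | h <;> linarith

/-- The second vector is `60 δ` applied to the sequence, `y0` being the newest value. The defect is
a quadratic form in seven vectors, diagonalised by completing squares. -/
theorem bdfLyapunov_le_add {B : LinearMap.BilinForm ℝ W} (hs : ∀ x y, B x y = B y x)
    (hB : ∀ x, 0 ≤ B x x) (y0 y1 y2 y3 y4 y5 y6 : W) :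
    bdfLyapunov B y0 y1 y2 y3 y4 y5 ≤ bdfLyapunov B y1 y2 y3 y4 y5 y6 +
      B ((36 : ℝ) • y0 - (52 : ℝ) • y1 + (25 : ℝ) • y2 - (4 : ℝ) • y3) (
        (147 : ℝ) • y0 - (360 : ℝ) • y1 + (450 : ℝ) • y2 - (400 : ℝ) • y3 + (225 : ℝ) • y4 -
        (72 : ℝ) • y5 + (10 : ℝ) • y6) := by
  unfold bdfLyapunov
  -- Six squares suffice for seven vectors: since `δ(1) = 0`, the defect vanishes on constant
  -- sequences, and so does each square.
  have e0 := hB (y0 - (288 / 83 : ℝ) • y1 + (465 / 83 : ℝ) • y2 - (536 / 83 : ℝ) • y3 +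
      (500 / 83 : ℝ) • y4 - (344 / 83 : ℝ) • y5 + (120 / 83 : ℝ) • y6)
  have e1 := hB (y1 - (9680 / 2919 : ℝ) • y2 + (41924 / 8757 : ℝ) • y3 - (4185 / 973 : ℝ) • y4 +
      (528 / 139 : ℝ) • y5 - (17240 / 8757 : ℝ) • y6)
  have e2 := hB (y2 - (625340 / 311487 : ℝ) • y3 + (179397 / 103829 : ℝ) • y4 -
      (198912 / 103829 : ℝ) • y5 + (372398 / 311487 : ℝ) • y6)
  have e3 := hB (y3 - (2684241 / 2376134 : ℝ) • y4 + (1687452 / 1188067 : ℝ) • y5 -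
      (3066797 / 2376134 : ℝ) • y6)
  have e4 := hB (y4 - (1131939 / 871250 : ℝ) • y5 + (260689 / 871250 : ℝ) • y6)
  have e5 := hB (y5 - y6)
  simp only [map_add, map_sub, map_smul, LinearMap.add_apply, LinearMap.sub_apply,
    LinearMap.smul_apply, smul_eq_mul, hs y1 y0, hs y2 y0, hs y3 y0, hs y4 y0,
    hs y5 y0, hs y6 y0, hs y2 y1, hs y3 y1, hs y4 y1, hs y5 y1, hs y6 y1, hs y3 y2, hs y4 y2,
    hs y5 y2, hs y6 y2, hs y4 y3, hs y5 y3, hs y6 y3, hs y5 y4, hs y6 y4, hs y6 y5]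
    at e0 e1 e2 e3 e4 e5 ⊢
  linear_combination (249 / 2) * e0 + (17514 / 83) * e1 + (519145 / 1946) * e2 +
    (23761340 / 311487) * e3 + (26137500 / 1188067) * e4 + (3185061 / 87125) * e5

/-- Completing squares from `y5` down to `y1` leaves a multiple of `B y0 y0` exceeding 100. The
constant 100 covers the later division by 60. -/
theorem le_bdfLyapunov {B : LinearMap.BilinForm ℝ W} (hs : ∀ x y, B x y = B y x)
    (hB : ∀ x, 0 ≤ B x x) (y0 y1 y2 y3 y4 y5 : W) :
    100 * B y0 y0 ≤ bdfLyapunov B y0 y1 y2 y3 y4 y5 := by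
  unfold bdfLyapunov
  have e0 := hB (-(12 / 25 : ℝ) • y0 + (516 / 325 : ℝ) • y1 - (774 / 325 : ℝ) • y2 +
      (708 / 325 : ℝ) • y3 - (48 / 25 : ℝ) • y4 + y5)
  have e1 := hB ((9012 / 10123 : ℝ) • y0 - (20382 / 10123 : ℝ) • y1 + (21348 / 10123 : ℝ) • y2 -
      (19566 / 10123 : ℝ) • y3 + y4)
  have e2 := hB (-(79331772 / 109343531 : ℝ) • y0 + (161108568 / 109343531 : ℝ) • y1 -
      (18074328 / 9940321 : ℝ) • y2 + y3)
  have e3 := hB ((1114774112 / 2444482191 : ℝ) • y0 - (1168114044 / 814827397 : ℝ) • y1 + y2)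
  have e4 := hB (-(1883756440300 / 1880743366627 : ℝ) • y0 + y1)
  have e5 := hB y0
  simp only [map_add, map_sub, map_smul, LinearMap.add_apply, LinearMap.sub_apply,
    LinearMap.smul_apply, smul_eq_mul, hs y1 y0, hs y2 y0, hs y3 y0, hs y4 y0,
    hs y5 y0, hs y2 y1, hs y3 y1, hs y4 y1, hs y5 y1, hs y3 y2, hs y4 y2, hs y5 y2, hs y4 y3,
    hs y5 y3, hs y5 y4]
    at e0 e1 e2 e3 e4 e5
  linear_combination 1625 * e0 + (10123 / 5) * e1 + (546717655 / 263198) * e2 +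
    (36667232865 / 19880642) * e3 + (28211150499405 / 17926202734) * e4 +
    (123120944226725 / 3761486733254) * e5

theorem bdfLyapunov_le {B : LinearMap.BilinForm ℝ W} (hs : ∀ x y, B x y = B y x)
    (hB : ∀ x, 0 ≤ B x x) (y0 y1 y2 y3 y4 y5 : W) :
    bdfLyapunov B y0 y1 y2 y3 y4 y5 ≤
      100000 * (B y0 y0 + B y1 y1 + B y2 y2 + B y3 y3 + B y4 y4 + B y5 y5) := by
  unfold bdfLyapunov
  have key : ∀ x y, B x y ≤ (B x x + B y y) / 2 ∧ -B x y ≤ (B x x + B y y) / 2 := fun x y => by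
    have := two_mul_abs_le hs hB x y
    constructor <;> linarith [le_abs_self (B x y), neg_abs_le (B x y)]
  -- The half of `key` chosen for each product follows the sign of its coefficient.
  linarith [hB y0, hB y1, hB y2, hB y3, hB y4, hB y5, (key y0 y1).2, (key y0 y2).1, (key y0 y3).2,
    (key y0 y4).1, (key y0 y5).2, (key y1 y2).2, (key y1 y3).1, (key y1 y4).2, (key y1 y5).1,
    (key y2 y3).2, (key y2 y4).1, (key y2 y5).2, (key y3 y4).2, (key y3 y5).1, (key y4 y5).2]

theorem multiplierLyapunov_le_add {B : LinearMap.BilinForm ℝ W} (hs : ∀ x y, B x y = B y x)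
    (hB : ∀ x, 0 ≤ B x x) (y0 y1 y2 y3 : W) :
    multiplierLyapunov B y0 y1 y2 + B y0 y0 ≤ multiplierLyapunov B y1 y2 y3 +
      B ((36 : ℝ) • y0 - (52 : ℝ) • y1 + (25 : ℝ) • y2 - (4 : ℝ) • y3) y0 := by
  unfold multiplierLyapunov
  have e0 := hB (y0 - (26 / 15 : ℝ) • y1 + (17 / 10 : ℝ) • y2 - (2 / 3 : ℝ) • y3)
  have e1 := hB (y1 - (327 / 314 : ℝ) • y2 + (295 / 314 : ℝ) • y3)
  have e2 := hB (y2 - (326 / 595 : ℝ) • y3)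
  have e3 := hB y3
  simp only [map_add, map_sub, map_smul, LinearMap.add_apply, LinearMap.sub_apply,
    LinearMap.smul_apply, smul_eq_mul, hs y1 y0, hs y2 y0, hs y3 y0, hs y2 y1,
    hs y3 y1, hs y3 y2]
    at e0 e1 e2 e3 ⊢
  linear_combination 3 * e0 + (314 / 75) * e1 + (119 / 628) * e2 + (1871 / 5950) * e3

theorem multiplierLyapunov_nonneg {B : LinearMap.BilinForm ℝ W} (hs : ∀ x y, B x y = B y x)
    (hB : ∀ x, 0 ≤ B x x) (y0 y1 y2 : W) :
    0 ≤ multiplierLyapunov B y0 y1 y2 := by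
  unfold multiplierLyapunov
  have e0 := hB (y0 - (13 / 20 : ℝ) • y1 + (37 / 160 : ℝ) • y2)
  have e1 := hB (y1 - (93 / 176 : ℝ) • y2)
  have e2 := hB y2
  simp only [map_add, map_sub, map_smul, LinearMap.add_apply, LinearMap.sub_apply,
    LinearMap.smul_apply, smul_eq_mul, hs y1 y0, hs y2 y0, hs y2 y1]
    at e0 e1 e2
  linear_combination 32 * e0 + (132 / 25) * e1 + (1559 / 704) * e2

theorem multiplierLyapunov_le {B : LinearMap.BilinForm ℝ W} (hs : ∀ x y, B x y = B y x)
    (hB : ∀ x, 0 ≤ B x x) (y0 y1 y2 : W) :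
    multiplierLyapunov B y0 y1 y2 ≤ 100 * (B y0 y0 + B y1 y1 + B y2 y2) := by
  unfold multiplierLyapunov
  have key : ∀ x y, B x y ≤ (B x x + B y y) / 2 ∧ -B x y ≤ (B x x + B y y) / 2 := fun x y => by
    have := two_mul_abs_le hs hB x y
    constructor <;> linarith [le_abs_self (B x y), neg_abs_le (B x y)]
  linarith [hB y0, hB y1, hB y2, (key y0 y1).2, (key y0 y2).1, (key y1 y2).2]

end BackwardDifference

/-! ### Coefficients of the six-step formula -/

theorem bdfPoly_six :
    bdfPoly 6 = .C (147 / 60) + .C (-6) * .X + .C (15 / 2) * .X ^ 2 + .C (-20 / 3) * .X ^ 3 +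
      .C (15 / 4) * .X ^ 4 + .C (-6 / 5) * .X ^ 5 + .C (1 / 6) * .X ^ 6 := by
  refine Polynomial.funext fun r => ?_
  simp only [bdfPoly, Polynomial.eval_finsetSum, Finset.sum_Icc_succ_top (Nat.le_add_left 1 _),
    Polynomial.eval_add, Polynomial.eval_mul, Polynomial.eval_C, Polynomial.eval_X,
    Polynomial.eval_pow, Polynomial.eval_sub, Polynomial.eval_one]
  norm_num [Finset.sum_Icc_succ_top]
  ring

/-! ### Energy estimate for abstract schemes -/

section EnergyEstimate

variable {W : Type*} [AddCommGroup W] [Module ℝ W]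

/-- The undivided six-step backward difference of `x` at `n`, meaningful for `n ≥ 6`. -/
def bdfDiff (x : ℕ → W) (n : ℕ) : W := ∑ i ∈ Finset.range (6 + 1), bdfCoeff 6 i • x (n - i)

theorem sixty_smul_bdfDiff (x : ℕ → W) (n : ℕ) :
    (60 : ℝ) • bdfDiff x n =
      (147 : ℝ) • x n - (360 : ℝ) • x (n - 1) + (450 : ℝ) • x (n - 2) - (400 : ℝ) • x (n - 3) +
        (225 : ℝ) • x (n - 4) - (72 : ℝ) • x (n - 5) + (10 : ℝ) • x (n - 6) := by
  simp only [bdfDiff, bdfCoeff, bdfPoly_six, Finset.sum_range_succ, Finset.sum_range_zero]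
  norm_num [Polynomial.coeff_X, Polynomial.coeff_C, Polynomial.coeff_X_pow]
  module

/-- Young's inequality, fed directly by the squared bound `residual`. -/
theorem abs_le_of_sq_le_mul {r a b ε : ℝ} (ha : 0 ≤ a) (hb : 0 ≤ b) (hε : 0 < ε)
    (h : r ^ 2 ≤ a * b) : |r| ≤ ε * b + a / (4 * ε) := by
  refine abs_le_of_sq_le_sq (h.trans ?_) (by positivity)
  have : (ε * b + a / (4 * ε)) ^ 2 = (ε * b - a / (4 * ε)) ^ 2 + a * b := by
    field_simp
    ring
  nlinarith [sq_nonneg (ε * b - a / (4 * ε))]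

/-- The forms `m` and `E` satisfy the six-step backward difference scheme up to step `N`, tested
with backward differences, with a right-hand side controlled by `ψ`. -/
structure IsBdfScheme (m E : LinearMap.BilinForm ℝ W) (x : ℕ → W) (ψ : ℕ → ℝ) (N : ℕ) :
    Prop where
  symm_m : ∀ v w, m v w = m w v
  nonneg_m : ∀ w, 0 ≤ m w w
  symm_E : ∀ v w, E v w = E w v
  nonneg_E : ∀ w, 0 ≤ E w w
  nonneg_ψ : ∀ n, 0 ≤ ψ n
  residual : ∀ n k, 6 ≤ n → n ≤ N → 6 ≤ k → k ≤ N →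
    (m (bdfDiff x n) (bdfDiff x k) + E (x n) (bdfDiff x k)) ^ 2 ≤
      ψ n * m (bdfDiff x k) (bdfDiff x k)

/-- The sum of the two Lyapunov functionals along the scheme. -/
def bdfPotential (m E : LinearMap.BilinForm ℝ W) (x : ℕ → W) (n : ℕ) : ℝ :=
  multiplierLyapunov m (bdfDiff x n) (bdfDiff x (n - 1)) (bdfDiff x (n - 2)) +
    bdfLyapunov E (x n) (x (n - 1)) (x (n - 2)) (x (n - 3)) (x (n - 4)) (x (n - 5)) / 60

namespace IsBdfScheme

variable {m E : LinearMap.BilinForm ℝ W} {x : ℕ → W} {ψ : ℕ → ℝ} {N : ℕ}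

/-- The crude bound for a single step. -/
theorem step_le (h : IsBdfScheme m E x ψ N) {n : ℕ} (h6 : 6 ≤ n) (hN : n ≤ N) :
    m (bdfDiff x n) (bdfDiff x n) / 2 + E (x n) (x n) ≤
      75 * (E (x (n - 1)) (x (n - 1)) + E (x (n - 2)) (x (n - 2)) + E (x (n - 3)) (x (n - 3)) +
        E (x (n - 4)) (x (n - 4)) + E (x (n - 5)) (x (n - 5)) + E (x (n - 6)) (x (n - 6))) +
      ψ n / 2 := by
  have hr := (le_abs_self _).trans (abs_le_of_sq_le_mul (h.nonneg_ψ n) (h.nonneg_m _) one_half_pos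
    (h.residual n n h6 hN h6 hN))
  -- The weight 20 keeps the total loss in `E (x n) (x n)` below the surplus of the leading
  -- coefficient 147/60 over 1. The largest other coefficient, 15/2, gives `75 = 10 · 15/2`.
  have key : ∀ y, |E (x n) y| ≤ E (x n) (x n) / 40 + 10 * E y y := fun y => by
    have := two_mul_abs_le h.symm_E h.nonneg_E (x n) ((20 : ℝ) • y)
    simp only [map_smul, LinearMap.smul_apply, smul_eq_mul, abs_mul] at this
    norm_num at this
    linarith
  have hd := congrArg (E (x n)) (sixty_smul_bdfDiff x n)
  simp only [map_add, map_sub, map_smul, smul_eq_mul] at hd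
  have k1 := abs_le.1 (key (x (n - 1)))
  have k2 := abs_le.1 (key (x (n - 2)))
  have k3 := abs_le.1 (key (x (n - 3)))
  have k4 := abs_le.1 (key (x (n - 4)))
  have k5 := abs_le.1 (key (x (n - 5)))
  have k6 := abs_le.1 (key (x (n - 6)))
  have e := h.nonneg_E
  linarith [e (x n), e (x (n - 1)), e (x (n - 2)), e (x (n - 3)), e (x (n - 4)), e (x (n - 5)),
    e (x (n - 6))]

/-- Adding the two Lyapunov inequalities, the second divided by 60, leaves exactly the
`μ`-combination of residuals tested with the newest difference. The oldest equation used is at `n -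
2`, whence `8 ≤ n`. -/
theorem potential_step (h : IsBdfScheme m E x ψ N) {n : ℕ} (h8 : 8 ≤ n) (hN : n + 1 ≤ N) :
    m (bdfDiff x (n + 1)) (bdfDiff x (n + 1)) / 2 + bdfPotential m E x (n + 1) ≤
      bdfPotential m E x n + 6000 * (ψ (n + 1) + ψ n + ψ (n - 1) + ψ (n - 2)) := by
  have hm := multiplierLyapunov_le_add h.symm_m h.nonneg_m (bdfDiff x (n + 1)) (bdfDiff x n)
    (bdfDiff x (n - 1)) (bdfDiff x (n - 2))
  have hE := bdfLyapunov_le_add h.symm_E h.nonneg_E (x (n + 1)) (x n) (x (n - 1)) (x (n - 2))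
    (x (n - 3)) (x (n - 4)) (x (n - 5))
  have hd := sixty_smul_bdfDiff x (n + 1)
  have i1 : n + 1 - 1 = n := by omega
  have i2 : n + 1 - 2 = n - 1 := by omega
  have i3 : n + 1 - 3 = n - 2 := by omega
  have i4 : n + 1 - 4 = n - 3 := by omega
  have i5 : n + 1 - 5 = n - 4 := by omega
  have i6 : n + 1 - 6 = n - 5 := by omega
  rw [i1, i2, i3, i4, i5, i6] at hd
  rw [← hd] at hE
  -- Each of the four residuals may absorb an eighth of the dissipation, so half survives; `2 · 52²
  -- ≤ 6000` fixes the constant.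
  have key : ∀ (c : ℝ) (i : ℕ), 0 < c → c ≤ 52 → 6 ≤ i → i ≤ n + 1 →
      c * |m (bdfDiff x i) (bdfDiff x (n + 1)) + E (x i) (bdfDiff x (n + 1))| ≤
        m (bdfDiff x (n + 1)) (bdfDiff x (n + 1)) / 8 + 6000 * ψ i := by
    intro c i hc hc' hi hi'
    have h1 := abs_le_of_sq_le_mul (h.nonneg_ψ i) (h.nonneg_m _)
      (show 0 < 1 / (8 * c) by positivity)
      (h.residual i (n + 1) hi (hi'.trans hN) (by omega) hN)
    have h2 := mul_le_mul_of_nonneg_left h1 hc.le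
    have h3 : c * (1 / (8 * c) * m (bdfDiff x (n + 1)) (bdfDiff x (n + 1)) +
        ψ i / (4 * (1 / (8 * c)))) =
        m (bdfDiff x (n + 1)) (bdfDiff x (n + 1)) / 8 + 2 * c ^ 2 * ψ i := by
      field_simp
      ring
    have h4 : 2 * c ^ 2 ≤ 6000 := by nlinarith
    nlinarith [mul_le_mul_of_nonneg_right h4 (h.nonneg_ψ i)]
  have k0 := key 36 (n + 1) (by norm_num) (by norm_num) (by omega) (by omega)
  have k1 := key 52 n (by norm_num) (by norm_num) (by omega) (by omega)
  have k2 := key 25 (n - 1) (by norm_num) (by norm_num) (by omega) (by omega)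
  have k3 := key 4 (n - 2) (by norm_num) (by norm_num) (by omega) (by omega)
  simp only [map_add, map_sub, map_smul, LinearMap.add_apply, LinearMap.sub_apply,
    LinearMap.smul_apply, smul_eq_mul] at hm hE
  simp only [bdfPotential, i1, i2, i3, i4, i5]
  have a0 := le_abs_self (m (bdfDiff x (n + 1)) (bdfDiff x (n + 1)) +
    E (x (n + 1)) (bdfDiff x (n + 1)))
  have a1 := neg_abs_le (m (bdfDiff x n) (bdfDiff x (n + 1)) + E (x n) (bdfDiff x (n + 1)))
  have a2 := le_abs_self (m (bdfDiff x (n - 1)) (bdfDiff x (n + 1)) +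
    E (x (n - 1)) (bdfDiff x (n + 1)))
  have a3 := neg_abs_le (m (bdfDiff x (n - 2)) (bdfDiff x (n + 1)) +
    E (x (n - 2)) (bdfDiff x (n + 1)))
  linarith

/-- Each `ψ i` enters at most four consecutive steps, whence `24000 = 4 · 6000`. The extra term on
the left reserves the uses still to come: three of `ψ n`, two of `ψ (n - 1)`, one of `ψ (n - 2)`. -/
theorem sum_add_potential_le (h : IsBdfScheme m E x ψ N) {n : ℕ} (h8 : 8 ≤ n) (hN : n ≤ N) :
    (∑ i ∈ Finset.Icc 6 n, m (bdfDiff x i) (bdfDiff x i)) / 2 + bdfPotential m E x n +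
        6000 * (3 * ψ n + 2 * ψ (n - 1) + ψ (n - 2)) ≤
      (∑ i ∈ Finset.Icc 6 8, m (bdfDiff x i) (bdfDiff x i)) / 2 + bdfPotential m E x 8 +
        24000 * ∑ i ∈ Finset.Icc 6 n, ψ i := by
  induction n, h8 using Nat.le_induction with
  | base =>
    have : ∑ i ∈ Finset.Icc 6 8, ψ i = ψ 6 + ψ 7 + ψ 8 := by
      simp [Finset.sum_Icc_succ_top]
    rw [this]
    norm_num
    linarith [h.nonneg_ψ 6, h.nonneg_ψ 7, h.nonneg_ψ 8]
  | succ n hn ih =>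
    have h1 := ih (by omega)
    have h2 := h.potential_step hn hN
    simp only [Finset.sum_Icc_succ_top (show 6 ≤ n + 1 by omega)]
    have i1 : n + 1 - 1 = n := by omega
    have i2 : n + 1 - 2 = n - 1 := by omega
    rw [i1, i2]
    linarith

theorem energy_le (h : IsBdfScheme m E x ψ N) :
    (∑ n ∈ Finset.Icc 6 N, m (bdfDiff x n) (bdfDiff x n)) + E (x N) (x N) ≤
      10 ^ 12 * (∑ i ∈ Finset.range 6, E (x i) (x i) + ∑ n ∈ Finset.Icc 6 N, ψ n) := by
  have e := h.nonneg_E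
  have hψ := h.nonneg_ψ
  have hm := h.nonneg_m
  have s6 : ∑ i ∈ Finset.range 6, E (x i) (x i) = E (x 0) (x 0) + E (x 1) (x 1) + E (x 2) (x 2) +
      E (x 3) (x 3) + E (x 4) (x 4) + E (x 5) (x 5) := by
    simp [Finset.sum_range_succ]
  have e0 := e (x 0)
  have e1 := e (x 1)
  have e2 := e (x 2)
  have e3 := e (x 3)
  have e4 := e (x 4)
  have e5 := e (x 5)
  rcases lt_or_ge N 6 with hN | hN
  -- No step is taken: the final value is one of the initial ones.
  · have : E (x N) (x N) ≤ ∑ i ∈ Finset.range 6, E (x i) (x i) :=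
      Finset.single_le_sum (f := fun i => E (x i) (x i)) (fun i _ => e (x i))
        (Finset.mem_range.2 hN)
    rw [Finset.Icc_eq_empty (by omega), Finset.sum_empty, Finset.sum_empty]
    linarith [e (x N)]
  have t6 := h.step_le le_rfl hN
  norm_num at t6
  have p6 := hψ 6
  have m6 := hm (bdfDiff x 6)
  have f6 := e (x 6)
  rcases hN.eq_or_lt with rfl | hN
  · simp only [Finset.Icc_self, Finset.sum_singleton]
    linarith
  have t7 := h.step_le (show 6 ≤ 7 by norm_num) hN
  norm_num at t7
  have p7 := hψ 7
  have m7 := hm (bdfDiff x 7)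
  have f7 := e (x 7)
  rcases (show 7 ≤ N from hN).eq_or_lt with rfl | hN
  · simp only [Finset.sum_Icc_succ_top (show 6 ≤ 6 + 1 by norm_num), Finset.Icc_self,
      Finset.sum_singleton]
    norm_num
    linarith
  have t8 := h.step_le (show 6 ≤ 8 by norm_num) hN
  norm_num at t8
  have p8 := hψ 8
  have m8 := hm (bdfDiff x 8)
  have f8 := e (x 8)
  have hle := h.sum_add_potential_le (show 8 ≤ N from hN) le_rfl
  have s8 : ∀ c : ℕ → ℝ, ∑ i ∈ Finset.Icc 6 8, c i = c 6 + c 7 + c 8 := fun c => by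
    simp [Finset.sum_Icc_succ_top]
  have hψ8 : ψ 6 + ψ 7 + ψ 8 ≤ ∑ i ∈ Finset.Icc 6 N, ψ i := by
    rw [← s8]
    exact Finset.sum_le_sum_of_subset_of_nonneg (Finset.Icc_subset_Icc le_rfl hN)
      fun i _ _ => hψ i
  have q1 := multiplierLyapunov_le h.symm_m h.nonneg_m (bdfDiff x 8) (bdfDiff x 7) (bdfDiff x 6)
  have q2 := bdfLyapunov_le h.symm_E h.nonneg_E (x 8) (x 7) (x 6) (x 5) (x 4) (x 3)
  have q3 := multiplierLyapunov_nonneg h.symm_m h.nonneg_m (bdfDiff x N) (bdfDiff x (N - 1))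
    (bdfDiff x (N - 2))
  have q4 := le_bdfLyapunov h.symm_E h.nonneg_E (x N) (x (N - 1)) (x (N - 2)) (x (N - 3))
    (x (N - 4)) (x (N - 5))
  rw [s8] at hle
  simp only [bdfPotential, Nat.reduceSub] at hle
  rw [s6]
  -- The potential at 8 is bounded by chaining the three crude steps; `10 ^ 12` generously covers
  -- their growth factors and the Lyapunov upper bounds.
  linarith [hψ N, hψ (N - 1), hψ (N - 2), e (x N)]

end IsBdfScheme

end EnergyEstimate

/-! ### The Stokes discretisation as an abstract scheme -/

section Instantiation

variable {d : ℕ} {Ω : Domain d}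

/-- The embedding of `V` in `H` as a linear map. -/
def V.toHₗ : V Ω →ₗ[ℝ] H Ω where
  toFun := V.toH
  map_add' _ _ := rfl
  map_smul' _ _ := rfl

/-- The partial derivative `∂_j u_i` as a linear map. -/
def V.gradₗ (i j : Fin d) : V Ω →ₗ[ℝ] L2 Ω where
  toFun u := u.grad i j
  map_add' _ _ := rfl
  map_smul' _ _ := rfl

theorem V.div_add (u v : V Ω) : (u + v).div = u.div + v.div :=
  Finset.sum_add_distrib (f := fun i => u.grad i i) (g := fun i => v.grad i i)

theorem V.div_smul (c : ℝ) (u : V Ω) : (c • u).div = c • u.div :=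
  (Finset.smul_sum (r := c) (f := fun i => u.grad i i) (s := Finset.univ)).symm

theorem V.div_zero : (0 : V Ω).div = 0 := by
  simpa using V.div_smul (0 : ℝ) (0 : V Ω)

theorem V.toHₗ_apply (u : V Ω) : V.toHₗ u = u.toH := rfl

theorem V.gradₗ_apply (i j : Fin d) (u : V Ω) : V.gradₗ i j u = u.grad i j := rfl

/-- The form `a` as a bilinear form. -/
def aBilin (ν : ℝ) : LinearMap.BilinForm ℝ (V Ω) :=
  ν • ∑ i, ∑ j, (innerₗ (L2 Ω)).compl₁₂ (V.gradₗ i j) (V.gradₗ i j)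

theorem aBilin_apply (ν : ℝ) (u v : V Ω) : aBilin ν u v = aForm ν u v := by
  simp [aBilin, aForm, V.gradₗ_apply, LinearMap.sum_apply]

theorem aForm_comm (ν : ℝ) (u v : V Ω) : aForm ν u v = aForm ν v u := by
  simp only [aForm, real_inner_comm]

theorem aForm_self_nonneg {ν : ℝ} (hν : 0 ≤ ν) (u : V Ω) : 0 ≤ aForm ν u u :=
  mul_nonneg hν (Finset.sum_nonneg fun _ _ => Finset.sum_nonneg fun _ _ => real_inner_self_nonneg)

variable {Vh : Submodule ℝ (V Ω)} {Qh : Submodule ℝ (L2 Ω)}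

/-- The energy form `a(u, v) + j(p, q)` on pairs of a velocity and a pressure. -/
def energyForm (Vh : Submodule ℝ (V Ω)) (ν : ℝ) (j : LinearMap.BilinForm ℝ Qh) :
    LinearMap.BilinForm ℝ (Vh × Qh) :=
  (aBilin ν).compl₁₂ (Vh.subtype ∘ₗ .fst ℝ Vh Qh) (Vh.subtype ∘ₗ .fst ℝ Vh Qh) +
    j.compl₁₂ (.snd ℝ Vh Qh) (.snd ℝ Vh Qh)

theorem energyForm_apply (ν : ℝ) (j : LinearMap.BilinForm ℝ Qh) (z w : Vh × Qh) :
    energyForm Vh ν j z w = aForm ν z.1.1 w.1.1 + j z.2 w.2 := by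
  simp [energyForm, aBilin_apply]

/-- The scaled `L²` form `τ⁻¹ (u, v)` on pairs of a velocity and a pressure. -/
def massForm (Vh : Submodule ℝ (V Ω)) (Qh : Submodule ℝ (L2 Ω)) (τ : ℝ) :
    LinearMap.BilinForm ℝ (Vh × Qh) :=
  (1 / τ) • (innerₗ (H Ω)).compl₁₂ (V.toHₗ ∘ₗ Vh.subtype ∘ₗ .fst ℝ Vh Qh)
    (V.toHₗ ∘ₗ Vh.subtype ∘ₗ .fst ℝ Vh Qh)

theorem massForm_apply (τ : ℝ) (z w : Vh × Qh) :
    massForm Vh Qh τ z w = 1 / τ * inner ℝ (V.toH z.1.1) (V.toH w.1.1) := by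
  simp [massForm, V.toHₗ_apply]

/-- The pairs of a discretely divergence-free velocity and a corresponding pressure. -/
def divFreePairs (Vh : Submodule ℝ (V Ω)) (j : LinearMap.BilinForm ℝ Qh) :
    Submodule ℝ (Vh × Qh) where
  carrier := {z | IsDiscretelyDivFree j z.1 z.2}
  zero_mem' r := by simp [bForm, V.div_zero]
  add_mem' {z w} hz hw r := by
    have h1 := hz r
    have h2 := hw r
    simp only [bForm, Prod.fst_add, Prod.snd_add, Submodule.coe_add, V.div_add, inner_add_right,
      map_add, LinearMap.add_apply] at h1 h2 ⊢
    linarith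
  smul_mem' c z hz r := by
    have h1 := hz r
    simp only [bForm, Prod.smul_fst, Prod.smul_snd, Submodule.coe_smul, V.div_smul,
      real_inner_smul_right, map_smul, LinearMap.smul_apply, smul_eq_mul] at h1 ⊢
    linear_combination c * h1

theorem bdfDiff_fst (u : ℕ → Vh) (p : ℕ → Qh) {τ : ℝ} (hτ : τ ≠ 0) (n : ℕ) :
    (bdfDiff (fun i => (u i, p i)) n).1 = τ • bdfDeriv 6 τ u n := by
  simp [bdfDiff, bdfDeriv, Prod.fst_sum, smul_smul, hτ]

theorem isBdfScheme_of_isStep {ν τ : ℝ} (hν : 0 ≤ ν) (hτ : 0 < τ) {j : LinearMap.BilinForm ℝ Qh}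
    (hj : IsStabilization j) {N : ℕ} {f : ℝ → H Ω} {u : ℕ → Vh} {p : ℕ → Qh}
    (h0 : ∀ i < 6, IsDiscretelyDivFree j (u i) (p i))
    (h : ∀ n, 6 ≤ n → n ≤ N → IsStep 6 ν τ f j u p n) :
    IsBdfScheme (massForm Vh Qh τ) (energyForm Vh ν j) (fun n => (u n, p n))
      (fun n => τ * ‖f (n * τ)‖ ^ 2) N where
  symm_m z w := by simp only [massForm_apply, real_inner_comm]
  nonneg_m z := by
    rw [massForm_apply]
    exact mul_nonneg (by positivity) real_inner_self_nonneg
  symm_E z w := by simp only [energyForm_apply, aForm_comm ν z.1.1, hj.symm z.2]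
  nonneg_E z := by
    rw [energyForm_apply]
    exact add_nonneg (aForm_self_nonneg hν _) (hj.nonneg _)
  nonneg_ψ n := by positivity
  residual n k hn hnN hk hkN := by
    have hmem : ∀ i ≤ N, (u i, p i) ∈ divFreePairs Vh j := fun i hi => by
      rcases lt_or_ge i 6 with hi6 | hi6
      · exact h0 i hi6
      · exact fun r => by rw [hj.symm]; exact (h i hi6 hi).continuity r
    set w := bdfDiff (fun n => (u n, p n)) k with hw
    -- The hypothesis on the initial values is needed here: for `k ≤ 11` the difference reaches back
    -- to them.
    have hdiv : w ∈ divFreePairs Vh j :=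
      Submodule.sum_mem _ fun i _ => Submodule.smul_mem _ _ (hmem (k - i) (by omega))
    have e1 := (h n hn hnN).momentum w.1
    have e2 := hdiv (p n)
    have e3 : massForm Vh Qh τ (bdfDiff (fun n => (u n, p n)) n) w =
        inner ℝ (V.toH (bdfDeriv 6 τ u n : Vh).1) (V.toH w.1.1) := by
      rw [massForm_apply, bdfDiff_fst u p hτ.ne']
      have : V.toH (τ • bdfDeriv 6 τ u n : Vh).1 = τ • V.toH (bdfDeriv 6 τ u n : Vh).1 := rfl
      rw [this, real_inner_smul_left]
      field_simp
    rw [e3, energyForm_apply, massForm_apply, hj.symm]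
    -- Testing the constraint for `w` with `p n` replaces `b(p n, w)` by the stabilization term.
    have e4 : inner ℝ (V.toH (bdfDeriv 6 τ u n : Vh).1) (V.toH w.1.1) +
        (aForm ν (u n).1 w.1.1 + j w.2 (p n)) = inner ℝ (f (n * τ)) (V.toH w.1.1) := by
      linarith
    rw [e4, real_inner_self_eq_norm_sq]
    -- The factors `τ` in `ψ` and `1 / τ` in the mass form cancel, leaving plain Cauchy–Schwarz.
    have e5 : τ * ‖f (n * τ)‖ ^ 2 * (1 / τ * ‖V.toH w.1.1‖ ^ 2) =
        (‖f (n * τ)‖ * ‖V.toH w.1.1‖) ^ 2 := by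
      field_simp
    rw [e5, ← sq_abs]
    exact pow_le_pow_left₀ (abs_nonneg _) (abs_real_inner_le_norm _ _) 2

theorem massForm_bdfDiff (u : ℕ → Vh) (p : ℕ → Qh) {τ : ℝ} (hτ : τ ≠ 0) (n : ℕ) :
    massForm Vh Qh τ (bdfDiff (fun i => (u i, p i)) n) (bdfDiff (fun i => (u i, p i)) n) =
      τ * ‖V.toH (bdfDeriv 6 τ u n : Vh).1‖ ^ 2 := by
  rw [massForm_apply, bdfDiff_fst u p hτ]
  have : V.toH (τ • bdfDeriv 6 τ u n : Vh).1 = τ • V.toH (bdfDeriv 6 τ u n : Vh).1 := rfl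
  rw [this, real_inner_smul_left, real_inner_smul_right, real_inner_self_eq_norm_sq]
  field_simp

theorem energyForm_self {ν : ℝ} (hν : 0 ≤ ν) {j : LinearMap.BilinForm ℝ Qh}
    (hj : IsStabilization j) (z : Vh × Qh) :
    energyForm Vh ν j z z = normV ν z.1.1 ^ 2 + seminormJ j z.2 ^ 2 := by
  rw [energyForm_apply, normV, seminormJ, Real.sq_sqrt (aForm_self_nonneg hν _),
    Real.sq_sqrt (hj.nonneg _)]

theorem ell2Norm_sq {W : Type*} [NormedAddCommGroup W] (q N : ℕ) {τ : ℝ} (hτ : 0 ≤ τ)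
    (w : ℕ → W) : ell2Norm q N τ w ^ 2 = ∑ n ∈ Finset.Icc q N, τ * ‖w n‖ ^ 2 := by
  rw [ell2Norm, Real.sq_sqrt (by positivity), Finset.mul_sum]

end Instantiation

end TransientStokes

end

theorem theorem5p2 :
    ∃ C : ℝ, 0 < C ∧
      ∀ (d : ℕ) (_ : d = 2 ∨ d = 3) (Ω : Domain d) (ν : ℝ) (_ : 0 < ν)
        (Th : Mesh Ω) (k l : ℕ) (_ : 1 ≤ k) (_ : k ≤ l + 1) (_ : l ≤ k)
        (Qh : Submodule ℝ (L2 Ω)) (_ : IsPressureSpace Th l Qh)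
        (j : LinearMap.BilinForm ℝ Qh) (_ : IsStabilization j)
        (T τ : ℝ) (_ : 0 < T) (_ : 0 < τ) (N : ℕ) (_ : N * τ ≤ T)
        (f : ℝ → H Ω) (_ : ContinuousOn f (Set.Icc 0 T))
        (u : ℕ → velocitySpace Th k) (p : ℕ → Qh)
        (_ : ∀ i < 6, IsDiscretelyDivFree j (u i) (p i))
        (_ : ∀ n, 6 ≤ n → n ≤ N → IsStep 6 ν τ f j u p n),
        ell2Norm 6 N τ (fun n => V.toH (bdfDeriv 6 τ u n).1) ^ 2
            + normV ν (u N).1 ^ 2 + seminormJ j (p N) ^ 2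
          ≤ C * (∑ i ∈ Finset.range 6, (normV ν (u i).1 ^ 2 + seminormJ j (p i) ^ 2)
              + ell2Norm 6 N τ (fun n => f (n * τ)) ^ 2) := by
  refine ⟨10 ^ 12, by norm_num, ?_⟩
  intro d _ Ω ν hν Th k l _ _ _ Qh _ j hj T τ _ hτ N _ f _ u p h0 h
  have key := (isBdfScheme_of_isStep hν.le hτ hj h0 h).energy_le
  simp only [massForm_bdfDiff _ _ hτ.ne', energyForm_self hν.le hj] at key
  rw [ell2Norm_sq _ _ hτ.le, ell2Norm_sq _ _ hτ.le, add_assoc]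
  exact key
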